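/- Let $\mathbf p=(p_i)_{i\ge 1}$ be a probability distribution on the positive integers and let $\alpha,t>0$. For a finite sequence of integers let $L(x_1,\dots,x_n)$ be the length of a longest strictly increasing subsequence, i.e. the largest $k\ge 0$ such that there are indices $1\le i_1<\dots<i_k\le n$ with $x_{i_1}<\dots<x_{i_k}$ (so it is $0$ for the empty sequence). Let $(X_k)_{k\ge1}$ be i.i.d. random variables with distribution $\mathbf p$, let $N_t$ be a Poisson random variable with mean $t$ independent of the sequence $(X_k)_{k\ge1}$, and put $L_{N_t}=L(X_1,\dots,X_{N_t})$. Then, after enlarging the underlying probability space if necessary, one can construct on the same probability space as $(X_k)_{k\ge 1}$ and $N_t$ * a sequence $(I_i)_{i\ge1}$ of independent random variables and a sequence $(J_i)_{i\ge1}$ of independent random variables, where for every $i\ge 1$ both $I_i$ and $J_i$ have the Bernoulli distribution with parameter $\frac{p_i}{\alpha+p_i}$ (the two sequences need not be independent of each other), and * a random variable $H$ (not necessarily independent of these sequences) with the Poisson distribution with mean $\alpha t$, such that, almost surely, $$L_{N_t}\le H+\sum_{i\ge1} I_i\qquad\text{and}\qquad L_{N_t}\ge \min\Big\{H\,;\,\sum_{i\ge1}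 J_i\Big\}.$$ -/

import Mathlib

open MeasureTheory ProbabilityTheory
open scoped NNReal ENNReal

universe u

/-- The positive integers carry the discrete σ-algebra. -/
instance instMeasurableSpacePNatDiscrete : MeasurableSpace ℕ+ := ⊤

instance instDiscreteMeasurableSpacePNat : DiscreteMeasurableSpace ℕ+ := ⟨fun _ => trivial⟩

/-- The length of a longest (strictly) increasing subsequence of the finite sequence
`x 0, …, x (n - 1)`: the largest `k` for which there are indices `i 0 < ⋯ < i (k - 1)` with
`x (i 0) < ⋯ < x (i (k - 1))`. The set below contains `0` and is bounded by `n`, so that the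
supremum is a maximum; the empty sequence has length `0`. -/
noncomputable def lisLength {S : Type*} [Preorder S] {n : ℕ} (x : Fin n → S) : ℕ :=
  sSup {k : ℕ | ∃ i : Fin k → Fin n, StrictMono i ∧ StrictMono (x ∘ i)}

/-- The number `p_i / (α + p_i)`, as an element of `[0, 1]`. -/
noncomputable def bernoulliParam (p : PMF ℕ+) (α : ℝ≥0) (i : ℕ+) : unitInterval :=
  ⟨(p i).toReal / ((α : ℝ) + (p i).toReal), by positivity,
    div_le_one_of_le₀ (le_add_of_nonneg_left α.coe_nonneg) (by positivity)⟩

/-- The Bernoulli distribution with parameter `q`, as a measure on `ℕ`: mass `q` at `1` and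
mass `1 - q` at `0`. -/
noncomputable def bernoulliNat (q : unitInterval) : Measure ℕ :=
  bernoulliMeasure 1 0 q

/-! Read the word X_1, …, X_N as the input of a discrete Hammersley process: a finite set of
particles on the sites, where each letter pulls the next particle on its right to itself, or one
from infinity. Add sources (an initial configuration S) and sinks (extra marks `none` in the word,
each absorbing the leftmost particle). A run turns S and the marks into a final configuration S' and
a list of outputs, where an output `none` means that no particle on the sites moved. Let H be the
number of these outputs. Conservation of particles gives sinks + |S'| = |S| + H.

The quantity sinks + |S'| is at least the length L of a longest increasing subsequence, and at most
max(|S|, sinks) + L. With the conservation law this becomes, for every S and every list of marks, L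
≤ H + |S| and L ≥ min(H, |S'|).

It remains to choose the laws. Let S have independent occupations with odds p_i/α, and insert
independently a Poisson(αt) number of sinks, uniformly shuffled among the letters. Each step is
invertible and preserves the weight of (configuration, mark), where letters weigh p_i and sinks α.
Hence the run preserves the joint law: S' is distributed as S, and the outputs as the marks, so H is
Poisson(αt). Then I and J are the occupations of S and S'. Finally this model is glued to the given
space along the common word. -/

section Combinatorics

/-! ### The Hammersley process: invertibility and conservation of particles. -/

variable {β : Type*} [LinearOrder β]

/-- One step of the discrete Hammersley process with sinks, on the particle configuration `S`.
A sink (`none`) absorbs the leftmost particle; a letter `i` attracts to `i` the first particle of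
`[i, ∞)`. The second component is the site which that particle left, or `none` if there was no
particle to move (so that one came from infinity). -/
def hammersleyStep (S : Finset β) : Option β → Finset β × Option β
  | none => if h : S.Nonempty then (S.erase (S.min' h), some (S.min' h)) else (S, none)
  | some i =>
    if h : (S.filter (i ≤ ·)).Nonempty then
      (insert i (S.erase ((S.filter (i ≤ ·)).min' h)), some ((S.filter (i ≤ ·)).min' h))
    else (insert i S, none)

/-- The inverse of `hammersleyStep`: the same dynamics run from right to left. -/
def hammersleyUnstep (S : Finset β) : Option β → Finset β × Option β
  | none => if h : S.Nonempty then (S.erase (S.max' h), some (S.max' h)) else (S, none)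
  | some j =>
    if h : (S.filter (· ≤ j)).Nonempty then
      (insert j (S.erase ((S.filter (· ≤ j)).max' h)), some ((S.filter (· ≤ j)).max' h))
    else (insert j S, none)

/-- The four kinds of steps of `hammersleyStep`, with `T` the set of the particles that stay. -/
inductive IsHammersleyStep : Finset β → Option β → Finset β → Option β → Prop
  | through : IsHammersleyStep ∅ none ∅ none
  | create (T : Finset β) (i : β) (h : ∀ x ∈ T, x < i) :
      IsHammersleyStep T (some i) (insert i T) none
  | absorb (T : Finset β) (j : β) (h : ∀ x ∈ T, j < x) :
      IsHammersleyStep (insert j T) none T (some j)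
  | move (T : Finset β) (i j : β) (hij : i ≤ j) (h : ∀ x ∈ T, x < i ∨ j < x) :
      IsHammersleyStep (insert j T) (some i) (insert i T) (some j)

theorem isHammersleyStep (S : Finset β) (m : Option β) :
    IsHammersleyStep S m (hammersleyStep S m).1 (hammersleyStep S m).2 := by
  cases m with
  | none =>
    by_cases h : S.Nonempty
    · simp only [hammersleyStep, h, dif_pos]
      have := IsHammersleyStep.absorb (S.erase (S.min' h)) (S.min' h)
        (fun x hx => S.min'_lt_of_mem_erase_min' h hx)
      rwa [Finset.insert_erase (S.min'_mem h)] at this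
    · obtain rfl := Finset.not_nonempty_iff_eq_empty.1 h
      simpa [hammersleyStep] using IsHammersleyStep.through
  | some i =>
    by_cases h : (S.filter (i ≤ ·)).Nonempty
    · simp only [hammersleyStep, h, dif_pos]
      set j := (S.filter (i ≤ ·)).min' h with hj
      have hjm := (S.filter (i ≤ ·)).min'_mem h
      rw [← hj, Finset.mem_filter] at hjm
      have := IsHammersleyStep.move (S.erase j) i j hjm.2 (fun x hx => by
        rw [Finset.mem_erase] at hx
        by_contra! hc
        exact hx.1 (le_antisymm hc.2
          (Finset.min'_le _ _ (Finset.mem_filter.2 ⟨hx.2, hc.1⟩))))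
      rwa [Finset.insert_erase hjm.1] at this
    · simp only [hammersleyStep, h, dif_neg, not_false_eq_true]
      refine IsHammersleyStep.create S i fun x hx => ?_
      by_contra! hc
      exact h ⟨x, Finset.mem_filter.2 ⟨hx, hc⟩⟩

/-- No staying particle lies between the old and the new site of the moving one, so seen from the
right the particle to move back is determined. -/
theorem IsHammersleyStep.unstep_eq {S S' : Finset β} {m m' : Option β}
    (h : IsHammersleyStep S m S' m') : hammersleyUnstep S' m' = (S, m) := by
  cases h with
  | through => simp [hammersleyUnstep]
  | create T i h =>
    have hne : (insert i S).Nonempty := Finset.insert_nonempty _ _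
    have hmax : (insert i S).max' hne = i := by
      refine le_antisymm (Finset.max'_le _ _ _ fun x hx => ?_)
        (Finset.le_max' _ _ (Finset.mem_insert_self _ _))
      rcases Finset.mem_insert.1 hx with rfl | hx
      exacts [le_rfl, (h x hx).le]
    have hi : i ∉ S := fun hi => lt_irrefl _ (h i hi)
    simp only [hammersleyUnstep, hne, dif_pos, hmax, Finset.erase_insert hi]
  | absorb T j h =>
    have hne : ¬ (S'.filter (· ≤ j)).Nonempty := by
      rintro ⟨x, hx⟩
      rw [Finset.mem_filter] at hx
      exact absurd (h x hx.1) (not_lt.2 hx.2)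
    simp only [hammersleyUnstep, hne, dif_neg, not_false_eq_true]
  | @move T i j hij h =>
    have hne : ((insert i T).filter (· ≤ j)).Nonempty :=
      ⟨i, Finset.mem_filter.2 ⟨Finset.mem_insert_self _ _, hij⟩⟩
    have hmax : ((insert i T).filter (· ≤ j)).max' hne = i := by
      refine le_antisymm (Finset.max'_le _ _ _ fun x hx => ?_)
        (Finset.le_max' _ _ (Finset.mem_filter.2 ⟨Finset.mem_insert_self i T, hij⟩))
      rw [Finset.mem_filter, Finset.mem_insert] at hx
      rcases hx with ⟨rfl | hx, hxj⟩
      · exact le_rfl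
      · exact ((h x hx).resolve_right (not_lt.2 hxj)).le
    have hi : i ∉ T := fun hi => (h i hi).elim (lt_irrefl _) (not_lt.2 hij)
    simp only [hammersleyUnstep, hne, dif_pos, hmax, Finset.erase_insert hi]

/-- The Hammersley process started at `S` and driven by a list of sinks and letters: its final
configuration, and the list of the sites left by the moving particles. -/
def hammersleyRun : Finset β → List (Option β) → Finset β × List (Option β)
  | S, [] => (S, [])
  | S, m :: l =>
    ((hammersleyRun (hammersleyStep S m).1 l).1,
      (hammersleyStep S m).2 :: (hammersleyRun (hammersleyStep S m).1 l).2)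

theorem hammersleyRun_injective :
    Function.Injective fun z : Finset β × List (Option β) => hammersleyRun z.1 z.2 := by
  rintro ⟨S, l⟩ ⟨S', l'⟩ h
  simp only at h
  induction l generalizing S S' l' with
  | nil => cases l' <;> simp_all [hammersleyRun]
  | cons m l ih =>
    cases l' with
    | nil => simp [hammersleyRun] at h
    | cons m' l' =>
      simp only [hammersleyRun, Prod.mk.injEq, List.cons.injEq] at h
      have h2 := ih _ _ _ (Prod.ext h.1 h.2.2)
      simp only [Prod.mk.injEq] at h2
      have h3 := (isHammersleyStep S m).unstep_eq
      rw [h2.1, h.2.1, (isHammersleyStep S' m').unstep_eq] at h3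
      simp_all

/-- Each particle of the final configuration was there at the beginning or came from infinity, and
each sink absorbed a particle. -/
theorem card_hammersleyRun (S : Finset β) (l : List (Option β)) :
    l.count none + (hammersleyRun S l).1.card = S.card + (hammersleyRun S l).2.count none := by
  induction l generalizing S with
  | nil => simp [hammersleyRun]
  | cons m l ih =>
    have h1 := ih (hammersleyStep S m).1
    have h2 : (if m = none then 1 else 0) + (hammersleyStep S m).1.card
        = S.card + (if (hammersleyStep S m).2 = none then 1 else 0) := by
      have h := isHammersleyStep S m
      generalize (hammersleyStep S m).1 = S', (hammersleyStep S m).2 = m' at h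
      cases h with
      | through => simp
      | create T i h =>
        have hi : i ∉ S := fun hi => lt_irrefl _ (h i hi)
        simp [hi]
      | absorb T j h =>
        have hi : j ∉ S' := fun hi => lt_irrefl _ (h j hi)
        simp [hi, add_comm]
      | move T i j hij h =>
        have hi : i ∉ T := fun hi => (h i hi).elim (lt_irrefl _) (not_lt.2 hij)
        have hj : j ∉ T := fun hj => (h j hj).elim (not_lt.2 hij) (lt_irrefl _)
        simp [hi, hj]
    simp only [hammersleyRun, List.count_cons, beq_iff_eq] at h1 h2 ⊢
    omega

theorem length_hammersleyRun (S : Finset β) (l : List (Option β)) :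
    (hammersleyRun S l).2.length = l.length := by
  induction l generalizing S with
  | nil => rfl
  | cons m l ih => simp [hammersleyRun, ih]

theorem hammersleyRun_append (S : Finset β) (l : List (Option β)) (m : Option β) :
    (hammersleyRun S (l ++ [m])).1 = (hammersleyStep (hammersleyRun S l).1 m).1 := by
  induction l generalizing S with
  | nil => rfl
  | cons a l ih => simp [hammersleyRun, ih]

/-! ### Effect of a step on the particle count in a lower set, and path lengths. -/

namespace IsHammersleyStep

variable {S S' : Finset β} {m m' : Option β} {D : Set β}

-- Letters only bring particles to the left, so a lower set can lose a particle only to a sink, and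
-- then just one.
open Classical in
theorem card_filter_le (h : IsHammersleyStep S m S' m') (hD : IsLowerSet D) :
    (S.filter (· ∈ D)).card ≤ (if m = none then 1 else 0) + (S'.filter (· ∈ D)).card := by
  cases h with
  | through => simp
  | create T i h =>
    simp only [reduceCtorEq, if_false, zero_add]
    exact Finset.card_le_card (Finset.filter_subset_filter _ (Finset.subset_insert _ _))
  | absorb T j h =>
    rw [if_pos rfl, Finset.filter_insert]
    split_ifs
    · have := Finset.card_insert_le j (S'.filter (· ∈ D))
      omega
    · simp
  | move T i j hij h =>
    have hi : i ∉ T := fun hi => (h i hi).elim (lt_irrefl _) (not_lt.2 hij)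
    simp only [reduceCtorEq, if_false, zero_add, Finset.filter_insert]
    split_ifs with h1 h2 h3
    · rw [Finset.card_insert_of_notMem (s := T.filter (· ∈ D)) (a := i) (by simp [hi])]
      exact Finset.card_insert_le _ _
    · exact absurd (hD hij h1) h2
    · exact Finset.card_le_card (Finset.subset_insert _ _)
    · exact le_rfl

open Classical in
theorem card_filter_lt_add_one_le {i : β} (h : IsHammersleyStep S (some i) S' m')
    (hD : IsLowerSet D) (hi : i ∈ D) :
    (S.filter (· < i)).card + 1 ≤ (S'.filter (· ∈ D)).card := by
  have key : ∀ T : Finset β, (T.filter (· < i)).card + 1 ≤ ((insert i T).filter (· ∈ D)).card := by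
    intro T
    rw [← Finset.card_insert_of_notMem (a := i) (s := T.filter (· < i)) (by simp)]
    refine Finset.card_le_card fun x hx => ?_
    simp only [Finset.mem_insert, Finset.mem_filter] at hx ⊢
    rcases hx with rfl | hx
    exacts [⟨Or.inl rfl, hi⟩, ⟨Or.inr hx.1, hD hx.2.le hi⟩]
  cases h with
  | create T i h => exact key _
  | move T i j hij h =>
    rw [Finset.filter_insert, if_neg (not_lt.2 hij)]
    exact key _

-- The count in `D` grows only if the particle arriving at `i` comes from outside `D`. As no
-- particle stays between its old site and `i`, all others in `D` are then below `i`. This is the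
-- dichotomy between skipping `i` and appending it to a subsequence.
open Classical in
theorem card_filter_le_of_letter {i : β} (h : IsHammersleyStep S (some i) S' m')
    (hD : IsLowerSet D) :
    (S'.filter (· ∈ D)).card ≤ (S.filter (· ∈ D)).card ∨
      i ∈ D ∧ (S'.filter (· ∈ D)).card ≤ (S.filter (· < i)).card + 1 := by
  cases h with
  | create T i h =>
    rw [Finset.filter_insert]
    split_ifs with h1
    · refine Or.inr ⟨h1, (Finset.card_insert_le _ _).trans (Nat.succ_le_succ ?_)⟩
      refine Finset.card_le_card fun x hx => ?_
      rw [Finset.mem_filter] at hx ⊢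
      exact ⟨hx.1, h x hx.1⟩
    · exact Or.inl le_rfl
  | move T i j hij h =>
    have hj : j ∉ T := fun hj => (h j hj).elim (not_lt.2 hij) (lt_irrefl _)
    by_cases h1 : i ∈ D
    · by_cases h2 : j ∈ D
      · left
        rw [Finset.filter_insert, Finset.filter_insert, if_pos h1, if_pos h2,
          Finset.card_insert_of_notMem (s := T.filter (· ∈ D)) (a := j) (by simp [hj])]
        exact Finset.card_insert_le _ _
      · refine Or.inr ⟨h1, ?_⟩
        rw [Finset.filter_insert, if_pos h1]
        refine (Finset.card_insert_le _ _).trans (Nat.succ_le_succ ?_)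
        refine Finset.card_le_card fun x hx => ?_
        rw [Finset.mem_filter] at hx ⊢
        refine ⟨Finset.mem_insert_of_mem hx.1, (h x hx.1).resolve_right fun hjx => ?_⟩
        exact h2 (hD hjx.le hx.2)
    · left
      rw [Finset.filter_insert, if_neg h1]
      exact Finset.card_le_card (Finset.filter_subset_filter _ (Finset.subset_insert _ _))

open Classical in
theorem card_filter_le_of_sink (h : IsHammersleyStep S none S' m') (hD : IsLowerSet D) :
    (S'.filter (· ∈ D)).card + 1 ≤ (S.filter (· ∈ D)).card ∨ (S'.filter (· ∈ D)).card = 0 := by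
  cases h with
  | through => simp
  | absorb T j h =>
    by_cases h1 : j ∈ D
    · left
      rw [Finset.filter_insert, if_pos h1, Finset.card_insert_of_notMem]
      simpa using fun hj => absurd (h j hj) (lt_irrefl _)
    · right
      rw [Finset.card_eq_zero, Finset.filter_eq_empty_iff]
      exact fun x hx hxD => h1 (hD (h x hx).le hxD)

end IsHammersleyStep

open Classical in
/-- An increasing subsequence of letters is no longer than the best path that may use sinks. -/
theorem length_le_of_sublist_reduceOption (S : Finset β) (l : List (Option β)) {D : Set β}
    (hD : IsLowerSet D) {c : List β} (hc : c.Sublist l.reduceOption) (hcs : c.Pairwise (· < ·))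
    (hcD : ∀ x ∈ c, x ∈ D) :
    c.length ≤ l.count none + ((hammersleyRun S l).1.filter (· ∈ D)).card := by
  induction l using List.reverseRecOn generalizing D c with
  | nil => simp_all
  | append_singleton l m ih =>
    rw [hammersleyRun_append]
    have hstep := isHammersleyStep (hammersleyRun S l).1 m
    have hmono := hstep.card_filter_le hD
    rw [List.reduceOption_append] at hc
    obtain ⟨c₁, c₂, rfl, h₁, h₂⟩ := List.sublist_append_iff.1 hc
    rw [List.pairwise_append] at hcs
    cases m with
    | none =>
      have : c₂ = [] := by simpa using h₂
      subst this
      have := ih hD h₁ hcs.1 (fun x hx => hcD x (by simp [hx]))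
      simp only [List.append_nil, List.count_append, List.count_singleton_self, if_true] at *
      omega
    | some i =>
      have hcount : (l ++ [some i]).count none = l.count none := by simp
      rw [hcount]
      simp only [reduceCtorEq, if_false, zero_add] at hmono
      rcases List.sublist_singleton.1 (by simpa using h₂) with rfl | rfl
      · have := ih hD h₁ hcs.1 (fun x hx => hcD x (by simp [hx]))
        rw [List.append_nil]
        omega
      -- If the last letter `i` is used, the earlier ones are below `i`: this is why the induction
      -- ranges over all lower sets.
      · have hi : i ∈ D := hcD i (by simp)
        have h3 := hstep.card_filter_lt_add_one_le hD hi
        have h4 := ih (isLowerSet_Iio i) h₁ hcs.1 (fun x hx => hcs.2.2 x hx i (by simp))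
        simp only [Set.mem_Iio] at h4
        rw [List.length_append, List.length_singleton]
        omega

open Classical in
/-- A path that may use sinks and sources consists of an increasing subsequence of letters and
either only sinks or only sources. -/
theorem exists_sublist_reduceOption (S : Finset β) (l : List (Option β)) {D : Set β}
    (hD : IsLowerSet D) :
    ∃ c : List β, c.Sublist l.reduceOption ∧ c.Pairwise (· < ·) ∧ (∀ x ∈ c, x ∈ D) ∧
      l.count none + ((hammersleyRun S l).1.filter (· ∈ D)).card ≤
        max S.card (l.count none) + c.length := by
  induction l using List.reverseRecOn generalizing D with
  | nil =>
    refine ⟨[], by simp, by simp, by simp, ?_⟩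
    simpa [hammersleyRun] using Finset.card_filter_le _ _
  | append_singleton l m ih =>
    rw [hammersleyRun_append]
    have hstep := isHammersleyStep (hammersleyRun S l).1 m
    rw [List.reduceOption_append]
    cases m with
    | none =>
      obtain ⟨c, h1, h2, h3, h4⟩ := ih hD
      refine ⟨c, by simpa using h1, h2, h3, ?_⟩
      -- Either the lost particle compensates the new sink, or `D` is empty and the sinks alone are
      -- bounded by the maximum.
      have := hstep.card_filter_le_of_sink hD
      simp only [List.count_append, List.count_singleton_self]
      omega
    | some i =>
      have hcount : (l ++ [some i]).count none = l.count none := by simp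
      rw [hcount]
      rcases hstep.card_filter_le_of_letter hD with h | ⟨hi, h⟩
      · obtain ⟨c, h1, h2, h3, h4⟩ := ih hD
        exact ⟨c, h1.trans (List.sublist_append_left _ _), h2, h3, by omega⟩
      · obtain ⟨c, h1, h2, h3, h4⟩ := ih (isLowerSet_Iio i)
        refine ⟨c ++ [i], h1.append (by simp), ?_, ?_, ?_⟩
        · rw [List.pairwise_append]
          exact ⟨h2, by simp, by simpa using h3⟩
        · simp only [List.mem_append, List.mem_singleton]
          rintro x (hx | rfl)
          exacts [hD (h3 x hx).le hi, hi]
        · simp only [Set.mem_Iio] at h4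
          rw [List.length_append, List.length_singleton]
          omega

/-! ### Bounds for the longest increasing subsequence. -/

theorem bddAbove_lisLength_set {S : Type*} [Preorder S] {n : ℕ} (x : Fin n → S) :
    BddAbove {k : ℕ | ∃ i : Fin k → Fin n, StrictMono i ∧ StrictMono (x ∘ i)} := by
  refine ⟨n, ?_⟩
  rintro k ⟨i, hi, -⟩
  simpa using Fintype.card_le_of_injective i hi.injective

/-- `lisLength` in terms of sublists. -/
theorem le_lisLength_get_iff (w : List β) (k : ℕ) :
    k ≤ lisLength w.get ↔ ∃ c : List β, c.Sublist w ∧ c.Pairwise (· < ·) ∧ k ≤ c.length := by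
  have hmem : lisLength w.get ∈
      {k : ℕ | ∃ i : Fin k → Fin w.length, StrictMono i ∧ StrictMono (w.get ∘ i)} :=
    Nat.sSup_mem ⟨0, Fin.elim0, fun i => i.elim0, fun i => i.elim0⟩ (bddAbove_lisLength_set _)
  constructor
  · intro hk
    obtain ⟨i, hi, hx⟩ := hmem
    refine ⟨List.ofFn (w.get ∘ i), ?_, ?_, by simpa using hk⟩
    · rw [List.sublist_iff_exists_fin_orderEmbedding_get_eq]
      refine ⟨(Fin.castOrderIso (by simp)).toOrderEmbedding.trans
        (OrderEmbedding.ofStrictMono i hi), fun j => ?_⟩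
      rw [List.get_ofFn]
      rfl
    · rw [List.pairwise_ofFn]
      exact fun a b hab => hx hab
  · rintro ⟨c, hcw, hc, hk⟩
    refine hk.trans (le_csSup (bddAbove_lisLength_set _) ?_)
    obtain ⟨f, hf⟩ := List.sublist_iff_exists_fin_orderEmbedding_get_eq.1 hcw
    refine ⟨f, f.strictMono, fun a b hab => ?_⟩
    simp only [Function.comp_apply, ← hf]
    exact List.pairwise_iff_get.1 hc a b hab

theorem lisLength_le_count_hammersleyRun_add_card (S : Finset β) (l : List (Option β)) :
    lisLength l.reduceOption.get ≤ (hammersleyRun S l).2.count none + S.card := by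
  obtain ⟨c, h1, h2, h3⟩ := (le_lisLength_get_iff l.reduceOption _).1 le_rfl
  have h4 := length_le_of_sublist_reduceOption S l isLowerSet_univ h1 h2 (by simp)
  have h5 := card_hammersleyRun S l
  simp only [Set.mem_univ, Finset.filter_true] at h4
  omega

theorem min_count_card_hammersleyRun_le_lisLength (S : Finset β) (l : List (Option β)) :
    min ((hammersleyRun S l).2.count none) (hammersleyRun S l).1.card
      ≤ lisLength l.reduceOption.get := by
  obtain ⟨c, h1, h2, h3, h4⟩ := exists_sublist_reduceOption S l isLowerSet_univ
  rw [le_lisLength_get_iff]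
  refine ⟨c, h1, h2, ?_⟩
  have h5 := card_hammersleyRun S l
  simp only [Set.mem_univ, Finset.filter_true] at h4
  omega

end Combinatorics

/-! ### Summation over the ways to insert sinks into a word. -/

section Lists

instance List.instMeasurableSpaceTop {β : Type*} : MeasurableSpace (List β) := ⊤

instance List.instDiscreteMeasurableSpace {β : Type*} : DiscreteMeasurableSpace (List β) :=
  ⟨fun _ => trivial⟩

/-- Decomposition of a list of marks according to its head. -/
def listOptionEquiv (β : Type*) :
    List (Option β) ≃ Unit ⊕ (List (Option β) ⊕ β × List (Option β)) where
  toFun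
    | [] => Sum.inl ()
    | none :: l => Sum.inr (Sum.inl l)
    | some i :: l => Sum.inr (Sum.inr (i, l))
  invFun := Sum.elim (fun _ => []) (Sum.elim (fun l => none :: l) fun z => some z.1 :: z.2)
  left_inv := by rintro (_ | ⟨_ | _, _⟩) <;> rfl
  right_inv := by rintro (_ | _ | _) <;> rfl

theorem tsum_list_option {β : Type*} (f : List (Option β) → ℝ≥0∞) :
    ∑' l, f l = f [] + (∑' l, f (none :: l) + ∑' (i : β) (l : List (Option β)), f (some i :: l)) := by
  rw [← (listOptionEquiv β).symm.tsum_eq, Summable.tsum_sum ENNReal.summable ENNReal.summable,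
    Summable.tsum_sum ENNReal.summable ENNReal.summable, ← ENNReal.tsum_prod]
  simp [listOptionEquiv]

variable {β : Type*} (p : β → ℝ≥0∞) (a : ℝ≥0∞)

/-- The rate of a mark: letters have rates `p`, and sinks have rate `a`. -/
def markRate : Option β → ℝ≥0∞
  | none => a
  | some i => p i

variable [DecidableEq β]

theorem length_reduceOption_add_count_none (l : List (Option β)) :
    l.reduceOption.length + l.count none = l.length := by
  induction l with
  | nil => rfl
  | cons m l ih => cases m <;> simp <;> omega

/-- The binomial coefficient counts the positions of the sinks; splitting on the first mark gives
Pascal's rule. -/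
theorem tsum_list_count_reduceOption (k : ℕ) (w : List β) :
    ∑' l : List (Option β), (if l.count none = k ∧ l.reduceOption = w
      then (l.map (markRate p a)).prod else 0)
      = ((w.length + k).choose k : ℝ≥0∞) * a ^ k * (w.map p).prod := by
  induction w generalizing k with
  | nil =>
    induction k with
    | zero =>
      rw [tsum_list_option]
      simp
    | succ k ih =>
      rw [tsum_list_option]
      simp only [List.count_nil, List.count_cons_self, List.reduceOption_cons_of_none,
        List.reduceOption_cons_of_some, Nat.add_right_cancel_iff, reduceCtorEq, and_false, if_false,
        List.map_cons, List.prod_cons, markRate, tsum_zero, add_zero]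
      simp_rw [← mul_ite_zero, ENNReal.tsum_mul_left]
      rw [ih]
      simp [pow_succ, mul_comm]
  | cons x w ihw =>
    have key : ∀ k, ∑' (i : β) (l : List (Option β)),
        (if (some i :: l).count none = k ∧ (some i :: l).reduceOption = x :: w
          then ((some i :: l).map (markRate p a)).prod else 0)
        = p x * (((w.length + k).choose k : ℝ≥0∞) * a ^ k * (w.map p).prod) := by
      intro k
      rw [tsum_eq_single x]
      · rw [← ihw, ← ENNReal.tsum_mul_left]
        refine tsum_congr fun l => ?_
        simp [markRate]
      · intro i hi
        simp [hi]
    induction k with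
    | zero =>
      rw [tsum_list_option, key]
      simp
    | succ k ih =>
      rw [tsum_list_option, key]
      have : ∑' l : List (Option β), (if (none :: l).count none = k + 1 ∧
          (none :: l).reduceOption = x :: w then ((none :: l).map (markRate p a)).prod else 0)
          = a * (((x :: w).length + k).choose k * a ^ k * ((x :: w).map p).prod) := by
        rw [← ih, ← ENNReal.tsum_mul_left]
        refine tsum_congr fun l => ?_
        simp [markRate]
      rw [this]
      have hch : ((x :: w).length + (k + 1)).choose (k + 1)
          = ((x :: w).length + k).choose k + (w.length + (k + 1)).choose (k + 1) := by
        rw [← add_assoc, Nat.choose_succ_succ]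
        congr 2
        simp only [List.length_cons]
        omega
      rw [hch]
      simp only [List.reduceOption_nil, reduceCtorEq, and_false, if_false, zero_add, List.map_cons,
        List.prod_cons]
      push_cast
      ring

end Lists

/-! ### Poisson splitting of the marks into letters and sinks. -/

section Marks

variable (p : PMF ℕ+) (α t : ℝ≥0)

/-- The law of the list of marks up to time `t`: a Poisson number of sinks and letters. -/
noncomputable def markListMeasure : Measure (List (Option ℕ+)) :=
  Measure.sum fun l => (poissonMeasure (t + α * t) {l.length} * ((1 + α : ℝ≥0∞)⁻¹) ^ l.length
    * (l.map (markRate p α)).prod) • Measure.dirac l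

theorem markListMeasure_singleton (l : List (Option ℕ+)) :
    markListMeasure p α t {l} = poissonMeasure (t + α * t) {l.length}
      * ((1 + α : ℝ≥0∞)⁻¹) ^ l.length * (l.map (markRate p α)).prod :=
  Measure.sum_smul_dirac_singleton

/-- Poisson thinning: among a Poisson number of marks with mean (1 + α)t, each is a sink with
probability α/(1 + α). -/
theorem poissonMeasure_mul_choose (n k : ℕ) :
    poissonMeasure (t + α * t) {n + k} * ((1 + α : ℝ≥0∞)⁻¹) ^ (n + k) * ((n + k).choose k * α ^ k)
      = poissonMeasure t {n} * poissonMeasure (α * t) {k} := by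
  have h1 : (1 + α : ℝ≥0∞)⁻¹ = ENNReal.ofReal ((1 + α : ℝ)⁻¹) := by
    rw [ENNReal.ofReal_inv_of_pos (by positivity), ENNReal.ofReal_add (by simp) (by simp)]
    simp
  have h2 : (α : ℝ≥0∞) = ENNReal.ofReal (α : ℝ) := by simp
  have h3 : (((n + k).choose k : ℕ) : ℝ≥0∞) = ENNReal.ofReal ((n + k).choose k : ℝ) := by simp
  rw [h1, h2, h3]
  simp only [poissonMeasure_singleton]
  rw [← ENNReal.ofReal_pow (by positivity), ← ENNReal.ofReal_pow (by positivity),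
    ← ENNReal.ofReal_mul (by positivity), ← ENNReal.ofReal_mul (by positivity),
    ← ENNReal.ofReal_mul (by positivity), ← ENNReal.ofReal_mul (by positivity)]
  congr 1
  rw [← Nat.choose_symm_add, Nat.cast_add_choose]
  push_cast
  have h4 : (t + α * t : ℝ) ^ (n + k) * ((1 + α : ℝ)⁻¹) ^ (n + k) = t ^ n * t ^ k := by
    rw [← mul_pow, ← pow_add]
    congr 1
    field_simp
  have h5 : Real.exp (-(t + α * t : ℝ)) = Real.exp (-t) * Real.exp (-(α * t)) := by
    rw [← Real.exp_add]; ring_nf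
  rw [h5, mul_pow (α : ℝ)]
  field_simp
  field_simp at h4
  rw [h4]
  ring

theorem map_markListMeasure {μW : Measure (List ℕ+)} [SFinite μW]
    (hμW : ∀ w, μW {w} = poissonMeasure t {w.length} * (w.map p).prod) :
    (markListMeasure p α t).map (fun l => (l.reduceOption, l.count none))
      = μW.prod (poissonMeasure (α * t)) := by
  classical
  refine Measure.ext_of_singleton fun ⟨w, k⟩ => ?_
  rw [Measure.map_apply (measurable_from_top) (measurableSet_singleton _),
    ← Set.singleton_prod_singleton, Measure.prod_prod, hμW,
    ← Measure.tsum_indicator_apply_singleton _ _ (DiscreteMeasurableSpace.forall_measurableSet _)]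
  calc _ = ∑' l : List (Option ℕ+), poissonMeasure (t + α * t) {w.length + k}
        * ((1 + α : ℝ≥0∞)⁻¹) ^ (w.length + k) * (if l.count none = k ∧ l.reduceOption = w
          then (l.map (markRate p α)).prod else 0) := by
        refine tsum_congr fun l => ?_
        rw [Set.indicator_apply]
        by_cases h : l.count none = k ∧ l.reduceOption = w
        · have hlen : l.length = w.length + k := by
            rw [← h.1, ← h.2, length_reduceOption_add_count_none]
          rw [if_pos h, if_pos (by simp [h]), markListMeasure_singleton, hlen]
        · rw [if_neg h, if_neg (by simpa [and_comm] using h), mul_zero]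
    _ = _ := by
        rw [ENNReal.tsum_mul_left, tsum_list_count_reduceOption, ← mul_assoc,
          poissonMeasure_mul_choose, mul_right_comm]

end Marks

/-! ### Coupling of two spaces along a countably-valued variable. -/

section Gluing

theorem sum_restrict_preimage_singleton {A E : Type*} [MeasurableSpace A] [MeasurableSpace E]
    [Countable E] [MeasurableSingletonClass E] (μ : Measure A) {f : A → E} (hf : Measurable f) :
    (Measure.sum fun e => μ.restrict (f ⁻¹' {e})) = μ := by
  rw [← Measure.restrict_iUnion _ fun e => hf (measurableSet_singleton e),
    ← Set.preimage_iUnion, Set.iUnion_of_singleton, Set.preimage_univ, Measure.restrict_univ]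
  intro e e' hne
  exact Disjoint.preimage f (by simpa using hne)

/-- Two probability spaces with equidistributed countably-valued variables `W` and `q` can be coupled
in such a way that `W = q` almost surely. -/
theorem exists_coupling_of_map_eq {Ω Z E : Type*} [MeasurableSpace Ω] [MeasurableSpace Z]
    [MeasurableSpace E] [Countable E] [MeasurableSingletonClass E] (P : Measure Ω) (Q : Measure Z)
    [IsProbabilityMeasure P] [IsProbabilityMeasure Q] {W : Ω → E} {q : Z → E} (hW : Measurable W)
    (hq : Measurable q) (h : P.map W = Q.map q) :
    ∃ ρ : Measure (Ω × Z), ρ.map Prod.fst = P ∧ ρ.map Prod.snd = Q ∧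
      ∀ᵐ x ∂ρ, W x.1 = q x.2 := by
  have hPQ : ∀ e, P (W ⁻¹' {e}) = Q (q ⁻¹' {e}) := fun e => by
    rw [← Measure.map_apply hW (measurableSet_singleton e), h,
      Measure.map_apply hq (measurableSet_singleton e)]
  -- Given the common value `e`, the two spaces are made independent; values of probability zero
  -- contribute nothing.
  refine ⟨Measure.sum fun e => (P.restrict (W ⁻¹' {e})).prod (Q[|q ⁻¹' {e}]), ?_, ?_, ?_⟩
  · rw [Measure.map_sum measurable_fst.aemeasurable]
    conv_rhs => rw [← sum_restrict_preimage_singleton P hW]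
    congr with e : 1
    rw [Measure.map_fst_prod]
    by_cases he : Q (q ⁻¹' {e}) = 0
    · rw [Measure.restrict_eq_zero.2 ((hPQ e).trans he), smul_zero]
    · have := cond_isProbabilityMeasure he
      rw [measure_univ, one_smul]
  · rw [Measure.map_sum measurable_snd.aemeasurable]
    conv_rhs => rw [← sum_restrict_preimage_singleton Q hq]
    congr with e : 1
    rw [Measure.map_snd_prod, Measure.restrict_apply_univ, hPQ]
    by_cases he : Q (q ⁻¹' {e}) = 0
    · rw [Measure.restrict_eq_zero.2 he, he, zero_smul]
    · rw [ProbabilityTheory.cond, smul_smul, ENNReal.mul_inv_cancel he (measure_ne_top _ _),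
        one_smul]
  · rw [Measure.ae_sum_iff]
    intro e
    have h1 : ∀ᵐ x ∂((P.restrict (W ⁻¹' {e})).prod (Q[|q ⁻¹' {e}])), W x.1 = e :=
      Measure.quasiMeasurePreserving_fst.ae (p := fun ω => W ω = e)
        (ae_restrict_mem (hW (measurableSet_singleton e)))
    have h2 : ∀ᵐ x ∂((P.restrict (W ⁻¹' {e})).prod (Q[|q ⁻¹' {e}])), q x.2 = e :=
      Measure.quasiMeasurePreserving_snd.ae (p := fun z => q z = e)
        (ae_cond_mem (hq (measurableSet_singleton e)))
    filter_upwards [h1, h2] with x hx1 hx2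
    rw [hx1, hx2]

end Gluing

/-! ### The stationary law of the sources. -/

section Sources

/-- The finite partial products satisfy the identity as soon as they contain `i`. The
cross-multiplied form avoids dividing by factors that may vanish. -/
theorem mul_tprod_eq_mul_tprod {ι : Type*} {f g : ι → ℝ≥0∞} {i : ι} (hf : ∀ j, f j ≤ 1)
    (hg : ∀ j, g j ≤ 1) (h : ∀ j, j ≠ i → f j = g j) :
    g i * ∏' j, f j = f i * ∏' j, g j := by
  classical
  have hF := ENNReal.Tendsto.const_mul (a := g i) (ENNReal.multipliable_of_le_one hf).hasProd
    (Or.inr (ne_top_of_le_ne_top ENNReal.one_ne_top (hg i)))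
  have hG := ENNReal.Tendsto.const_mul (a := f i) (ENNReal.multipliable_of_le_one hg).hasProd
    (Or.inr (ne_top_of_le_ne_top ENNReal.one_ne_top (hf i)))
  refine tendsto_nhds_unique (hF.congr' ?_) hG
  simp only [SummationFilter.unconditional_filter]
  filter_upwards [Filter.eventually_ge_atTop ({i} : Finset ι)] with s hs
  have his : i ∈ s := hs (Finset.mem_singleton_self i)
  rw [← Finset.mul_prod_erase s f his, ← Finset.mul_prod_erase s g his,
    Finset.prod_congr rfl fun j hj => h j (Finset.ne_of_mem_erase hj)]
  exact mul_left_comm _ _ _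

/-- The configuration `S`, as a family of `0`-`1` variables. -/
def occupation (S : Finset ℕ+) (i : ℕ+) : ℕ := if i ∈ S then 1 else 0

theorem occupation_injective : Function.Injective occupation := by
  intro S T h
  ext i
  have := congrFun h i
  simp only [occupation] at this
  split_ifs at this <;> simp_all

theorem measurableEmbedding_occupation : MeasurableEmbedding occupation where
  injective := occupation_injective
  measurable := .of_discrete
  measurableSet_image' := fun {s} _ => (s.to_countable.image occupation).measurableSet

instance isProbabilityMeasure_bernoulliNat (q : unitInterval) :
    IsProbabilityMeasure (bernoulliNat q) := by
  unfold bernoulliNat; infer_instance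

variable (p : PMF ℕ+) (α : ℝ≥0)

/-- The law of the initial configuration: independent Bernoulli variables. -/
noncomputable def sourceMeasure : Measure (Finset ℕ+) :=
  (Measure.infinitePi fun i => bernoulliNat (bernoulliParam p α i)).comap occupation

theorem bernoulliNat_singleton_one (q : unitInterval) :
    bernoulliNat q {1} = ENNReal.ofReal q := by
  rw [bernoulliNat, bernoulliMeasure_apply_of_mem_of_notMem _ (by simp) (by simp) (by simp)]
  simp [ENNReal.ofReal, unitInterval.toNNReal, Real.toNNReal_of_nonneg q.2.1]
  rfl

theorem bernoulliNat_singleton_zero (q : unitInterval) :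
    bernoulliNat q {0} = ENNReal.ofReal (1 - q) := by
  rw [bernoulliNat, bernoulliMeasure_apply_of_notMem_of_mem _ (by simp) (by simp) (by simp)]
  have : (0 : ℝ) ≤ 1 - q := sub_nonneg.2 q.2.2
  simp [ENNReal.ofReal, unitInterval.toNNReal, Real.toNNReal_of_nonneg this]
  rfl

theorem bernoulliNat_compl (q : unitInterval) : bernoulliNat q {0, 1}ᶜ = 0 := by
  rw [bernoulliNat, bernoulliMeasure_apply_of_notMem_of_notMem _
    (DiscreteMeasurableSpace.forall_measurableSet _) (by simp) (by simp)]

variable {α}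

theorem add_mul_bernoulliParam (hα : 0 < α) (i : ℕ+) :
    (α + p i) * ENNReal.ofReal (bernoulliParam p α i) = p i := by
  have h1 : p i = ENNReal.ofReal (p i).toReal := (ENNReal.ofReal_toReal (p.apply_ne_top i)).symm
  have h2 : (α : ℝ≥0∞) = ENNReal.ofReal α := by simp
  have h3 : (0 : ℝ) < α := hα
  conv_lhs => rw [h1]
  conv_rhs => rw [h1]
  rw [h2, ← ENNReal.ofReal_add h3.le ENNReal.toReal_nonneg, ← ENNReal.ofReal_mul (by positivity),
    bernoulliParam, mul_div_cancel₀ _ (by positivity)]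

theorem add_mul_one_sub_bernoulliParam (hα : 0 < α) (i : ℕ+) :
    (α + p i) * ENNReal.ofReal (1 - bernoulliParam p α i) = α := by
  have h1 : p i = ENNReal.ofReal (p i).toReal := (ENNReal.ofReal_toReal (p.apply_ne_top i)).symm
  have h2 : (α : ℝ≥0∞) = ENNReal.ofReal α := by simp
  have h3 : (0 : ℝ) < α := hα
  conv_lhs => rw [h1]
  rw [h2, ← ENNReal.ofReal_add h3.le ENNReal.toReal_nonneg, ← ENNReal.ofReal_mul (by positivity),
    bernoulliParam, mul_sub, mul_div_cancel₀ _ (by positivity)]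
  congr 1
  ring

theorem map_occupation_sourceMeasure (hα : 0 < α) :
    (sourceMeasure p α).map occupation
      = Measure.infinitePi fun i => bernoulliNat (bernoulliParam p α i) := by
  rw [sourceMeasure, measurableEmbedding_occupation.map_comap, Measure.restrict_eq_self_of_ae_mem]
  set μ := Measure.infinitePi fun i => bernoulliNat (bernoulliParam p α i) with hμ
  have heval : ∀ i (s : Set ℕ), μ {f | f i ∈ s} = bernoulliNat (bernoulliParam p α i) s := by
    intro i s
    rw [← Measure.infinitePi_map_eval (fun i => bernoulliNat (bernoulliParam p α i)) i,
      Measure.map_apply (measurable_pi_apply i) (DiscreteMeasurableSpace.forall_measurableSet _)]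
    rfl
  -- Borel–Cantelli: the parameters are at most p_i/α and so sum to at most 1/α. Hence almost every
  -- family is the occupation of a finite set.
  have h1 : ∀ᵐ f ∂μ, {i | f ∈ {f : ℕ+ → ℕ | f i ∈ ({1} : Set ℕ)}}.Finite := by
    refine ae_finite_setOfPred_mem (ne_top_of_le_ne_top (b := (α : ℝ≥0∞)⁻¹) (by simp [hα.ne']) ?_)
    simp_rw [heval, bernoulliNat_singleton_one]
    calc _ ≤ ∑' i, (α : ℝ≥0∞)⁻¹ * p i := by
          refine ENNReal.tsum_le_tsum fun i => ?_
          rw [mul_comm, ← div_eq_mul_inv, ENNReal.le_div_iff_mul_le (by simp [hα.ne']) (by simp),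
            mul_comm]
          conv_rhs => rw [← add_mul_bernoulliParam p hα i]
          exact mul_le_mul_left (self_le_add_right _ _) _
      _ = _ := by rw [ENNReal.tsum_mul_left, p.tsum_coe, mul_one]
  have h2 : ∀ᵐ f ∂μ, ∀ i, f i ∈ ({0, 1} : Set ℕ) := by
    rw [ae_all_iff]
    intro i
    exact (heval i _).trans (bernoulliNat_compl _)
  filter_upwards [h1, h2] with f hf1 hf2
  refine ⟨hf1.toFinset, funext fun i => ?_⟩
  have := hf2 i
  simp only [Set.mem_insert_iff, Set.mem_singleton_iff] at this
  rcases this with h | h <;> simp [occupation, h]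

theorem isProbabilityMeasure_sourceMeasure (hα : 0 < α) :
    IsProbabilityMeasure (sourceMeasure p α) := by
  have : IsProbabilityMeasure ((sourceMeasure p α).map occupation) := by
    rw [map_occupation_sourceMeasure p hα]; infer_instance
  exact Measure.isProbabilityMeasure_of_map occupation

/-- Only the factor at `i` changes, and its odds are p_i/α. This is why the Bernoulli parameter is
p_i/(α + p_i). -/
theorem sourceMeasure_insert (hα : 0 < α) {S : Finset ℕ+} {i : ℕ+} (hi : i ∉ S) :
    α * sourceMeasure p α {insert i S} = p i * sourceMeasure p α {S} := by
  simp only [sourceMeasure, measurableEmbedding_occupation.comap_apply, Set.image_singleton,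
    Measure.infinitePi_singleton]
  have key := mul_tprod_eq_mul_tprod (i := i)
    (f := fun j => bernoulliNat (bernoulliParam p α j) {occupation (insert i S) j})
    (g := fun j => bernoulliNat (bernoulliParam p α j) {occupation S j})
    (fun _ => prob_le_one) (fun _ => prob_le_one)
    (fun j hj => by simp only [occupation, Finset.mem_insert, hj, false_or])
  simp only [occupation, Finset.mem_insert_self, if_true, hi, if_false,
    bernoulliNat_singleton_zero, bernoulliNat_singleton_one] at key
  conv_lhs => rw [← add_mul_one_sub_bernoulliParam p hα i]
  conv_rhs => enter [1]; rw [← add_mul_bernoulliParam p hα i]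
  rw [mul_assoc, mul_assoc]
  exact congrArg _ key

end Sources

/-! ### Invariance of the joint law under the run. -/

section Burke

variable (p : PMF ℕ+) {α : ℝ≥0} (t : ℝ≥0)

/-- Reversibility of the sources for one step. -/
theorem sourceMeasure_mul_markRate (hα : 0 < α) {S S' : Finset ℕ+} {m m' : Option ℕ+}
    (h : IsHammersleyStep S m S' m') :
    sourceMeasure p α {S} * markRate p α m = sourceMeasure p α {S'} * markRate p α m' := by
  cases h with
  | through => rfl
  | create T i h =>
    have hi : i ∉ S := fun hi => lt_irrefl _ (h i hi)
    simp only [markRate]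
    rw [mul_comm _ (α : ℝ≥0∞), sourceMeasure_insert p hα hi, mul_comm]
  | absorb T j h =>
    have hj : j ∉ S' := fun hj => lt_irrefl _ (h j hj)
    simp only [markRate]
    rw [mul_comm _ (α : ℝ≥0∞), sourceMeasure_insert p hα hj, mul_comm]
  | move T i j hij h =>
    have hi : i ∉ T := fun hi => (h i hi).elim (lt_irrefl _) (not_lt.2 hij)
    have hj : j ∉ T := fun hj => (h j hj).elim (not_lt.2 hij) (lt_irrefl _)
    have hα' : (α : ℝ≥0∞) ≠ 0 := by simp [hα.ne']
    simp only [markRate]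
    -- After multiplication by α both sides reduce to p_i p_j times the mass of `T`.
    rw [← ENNReal.mul_right_inj hα' ENNReal.coe_ne_top, ← mul_assoc, ← mul_assoc,
      sourceMeasure_insert p hα hi, sourceMeasure_insert p hα hj]
    ring

theorem sourceMeasure_mul_prod_markRate (hα : 0 < α) (S : Finset ℕ+) (l : List (Option ℕ+)) :
    sourceMeasure p α {S} * (l.map (markRate p α)).prod
      = sourceMeasure p α {(hammersleyRun S l).1}
        * ((hammersleyRun S l).2.map (markRate p α)).prod := by
  induction l generalizing S with
  | nil => rfl
  | cons m l ih =>
    simp only [hammersleyRun, List.map_cons, List.prod_cons]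
    rw [← mul_assoc, sourceMeasure_mul_markRate p hα (isHammersleyStep S m), mul_right_comm, ih]
    ring

/-- An injective map that preserves the masses of points preserves a probability measure on a
countable space. -/
theorem map_eq_self_of_injective {Z : Type*} [MeasurableSpace Z] [Countable Z]
    [MeasurableSingletonClass Z] (Q : Measure Z) [IsProbabilityMeasure Q] {f : Z → Z}
    (hf : Function.Injective f) (h : ∀ z, Q {f z} = Q {z}) : Q.map f = Q := by
  classical
  have hfm : Measurable f := measurable_of_countable f
  have := Measure.isProbabilityMeasure_map (μ := Q) hfm.aemeasurable
  -- One inequality suffices because both total masses are 1, so surjectivity of `f` need not be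
  -- checked.
  refine Measure.eq_of_le_of_isProbabilityMeasure (Measure.le_iff.2 fun s hs => ?_)
  rw [Measure.map_apply hfm hs, ← Measure.tsum_indicator_apply_singleton _ _ (hfm hs),
    ← Measure.tsum_indicator_apply_singleton _ _ hs]
  refine le_trans (le_of_eq ?_) (ENNReal.tsum_comp_le_tsum_of_injective hf _)
  refine tsum_congr fun z => ?_
  rw [Set.indicator_apply, Set.indicator_apply, h]
  rfl

/-- The analogue of Burke's theorem: the process run from a stationary configuration has the same law
as its time reversal. -/
theorem map_hammersleyRun (hα : 0 < α) [IsProbabilityMeasure (sourceMeasure p α)]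
    [IsProbabilityMeasure (markListMeasure p α t)] :
    ((sourceMeasure p α).prod (markListMeasure p α t)).map (fun z => hammersleyRun z.1 z.2)
      = (sourceMeasure p α).prod (markListMeasure p α t) := by
  refine map_eq_self_of_injective _ hammersleyRun_injective fun ⟨S, l⟩ => ?_
  have hmul : ∀ z : Finset ℕ+ × List (Option ℕ+),
      (sourceMeasure p α).prod (markListMeasure p α t) {z}
        = sourceMeasure p α {z.1} * markListMeasure p α t {z.2} := fun z => by
    rw [← Measure.prod_prod, Set.singleton_prod_singleton]
  rw [hmul, hmul, markListMeasure_singleton, markListMeasure_singleton, length_hammersleyRun,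
    mul_left_comm, mul_left_comm (sourceMeasure p α {S}), sourceMeasure_mul_prod_markRate p hα S l]

end Burke

/-! ### The law of the random word of Poisson length. -/

section Words

theorem preimage_ofFn_singleton {Ω : Type*} (X : ℕ → Ω → ℕ+) (N : Ω → ℕ) (w : List ℕ+) :
    (fun ω => List.ofFn fun k : Fin (N ω) => X k ω) ⁻¹' {w}
      = N ⁻¹' {w.length} ∩ ⋂ k ∈ (Finset.univ : Finset (Fin w.length)), X k ⁻¹' {w.get k} := by
  ext ω
  simp only [Set.mem_preimage, Set.mem_singleton_iff, Set.mem_inter_iff, Set.mem_iInter,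
    Finset.mem_univ, forall_true_left]
  constructor
  · rintro rfl
    refine ⟨by simp, fun k => ?_⟩
    rw [List.get_ofFn]
    rfl
  · rintro ⟨h1, h2⟩
    refine List.ext_get (by simpa using h1) fun n hn hn' => ?_
    rw [List.get_ofFn, ← h2]
    rfl

variable {Ω : Type*} [MeasurableSpace Ω] {P : Measure Ω} {X : ℕ → Ω → ℕ+} {N : Ω → ℕ}

theorem measurable_ofFn (hX : ∀ k, Measurable (X k)) (hN : Measurable N) :
    Measurable fun ω => List.ofFn fun k : Fin (N ω) => X k ω := by
  refine measurable_to_countable' fun w => ?_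
  rw [preimage_ofFn_singleton]
  exact (hN (measurableSet_singleton _)).inter
    (Finset.measurableSet_biInter _ fun k _ => hX k (measurableSet_singleton _))

theorem map_ofFn_singleton [IsProbabilityMeasure P] {p : PMF ℕ+} {t : ℝ≥0}
    (hX_meas : ∀ k, Measurable (X k))
    (hX_law : ∀ k, P.map (X k) = p.toMeasure) (hX_indep : iIndepFun X P)
    (hN_meas : Measurable N) (hN_law : P.map N = poissonMeasure t)
    (hXN : IndepFun N (fun ω k => X k ω) P) (w : List ℕ+) :
    P.map (fun ω => List.ofFn fun k : Fin (N ω) => X k ω) {w}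
      = poissonMeasure t {w.length} * (w.map p).prod := by
  rw [Measure.map_apply (measurable_ofFn hX_meas hN_meas) (measurableSet_singleton _),
    preimage_ofFn_singleton]
  have hset : (⋂ k ∈ (Finset.univ : Finset (Fin w.length)), X k ⁻¹' {w.get k})
      = (fun ω k => X k ω) ⁻¹' (⋂ k ∈ (Finset.univ : Finset (Fin w.length)),
        (fun x : ℕ → ℕ+ => x k) ⁻¹' {w.get k}) := by
    simp only [Set.preimage_iInter]
    rfl
  have h1 := hXN.measure_inter_preimage_eq_mul {w.length} (⋂ k ∈ (Finset.univ : Finset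
    (Fin w.length)), (fun x : ℕ → ℕ+ => x k) ⁻¹' {w.get k}) (measurableSet_singleton _)
    (Finset.measurableSet_biInter _ fun k _ =>
      measurable_pi_apply (k : ℕ) (measurableSet_singleton _))
  have h2 := (hX_indep.precomp (g := fun k : Fin w.length => (k : ℕ))
    Fin.val_injective).measure_inter_preimage_eq_mul Finset.univ (sets := fun k => {w.get k})
    fun _ _ => measurableSet_singleton _
  rw [← hset] at h1
  rw [h1, ← Measure.map_apply hN_meas (measurableSet_singleton _), hN_law]
  congr 1
  refine h2.trans ?_
  have h3 : ∀ k : Fin w.length, P (X k ⁻¹' {w.get k}) = p (w.get k) := fun k => by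
    rw [← Measure.map_apply (hX_meas k) (measurableSet_singleton _), hX_law,
      PMF.toMeasure_apply_singleton _ _ (measurableSet_singleton _)]
  rw [Finset.prod_congr rfl fun k _ => h3 k, ← List.prod_ofFn]
  congr 1
  refine List.ext_get (by simp) fun n hn hn' => ?_
  simp

theorem lisLength_get_ofFn {S : Type*} [Preorder S] {n : ℕ} (x : Fin n → S) :
    lisLength (List.ofFn x).get = lisLength x := by
  -- The length of `List.ofFn x` equals `n` only propositionally, hence the cast.
  have : ∀ (m : ℕ) (h : m = n), lisLength (fun k : Fin m => x (k.cast h)) = lisLength x := by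
    rintro m rfl; rfl
  rw [← this _ List.length_ofFn]
  congr 1
  funext k
  exact List.get_ofFn x k

end Words

/-! ### Assembly of the coupling. -/

theorem bernoulli_occupation {Ω : Type*} [MeasurableSpace Ω] {P : Measure Ω}
    [IsProbabilityMeasure P] (p : PMF ℕ+) {α : ℝ≥0} (hα : 0 < α) {T : Ω → Finset ℕ+}
    (hT : Measurable T) (hlaw : P.map T = sourceMeasure p α) :
    (∀ i, Measurable fun ω => occupation (T ω) i) ∧
      (∀ i, P.map (fun ω => occupation (T ω) i) = bernoulliNat (bernoulliParam p α i)) ∧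
      iIndepFun (fun i ω => occupation (T ω) i) P := by
  have hm : Measurable fun ω => occupation (T ω) :=
    measurableEmbedding_occupation.measurable.comp hT
  have hmi : ∀ i, Measurable fun ω => occupation (T ω) i := fun i => (measurable_pi_apply i).comp hm
  have h1 : P.map (fun ω => occupation (T ω))
      = Measure.infinitePi fun i => bernoulliNat (bernoulliParam p α i) := by
    rw [← map_occupation_sourceMeasure p hα, ← hlaw,
      Measure.map_map measurableEmbedding_occupation.measurable hT]
    rfl
  have h2 : ∀ i, P.map (fun ω => occupation (T ω) i) = bernoulliNat (bernoulliParam p α i) := by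
    intro i
    rw [← Measure.infinitePi_map_eval (fun i => bernoulliNat (bernoulliParam p α i)) i, ← h1,
      Measure.map_map (measurable_pi_apply i) hm]
    rfl
  refine ⟨hmi, h2, (iIndepFun_iff_map_fun_eq_infinitePi_map hmi).2 ?_⟩
  simp_rw [h2]
  exact h1

theorem tsum_occupation (S : Finset ℕ+) : ∑' i, (occupation S i : ℝ≥0∞) = S.card := by
  rw [tsum_eq_sum (s := S) (fun i hi => by simp [occupation, hi]),
    Finset.sum_congr rfl (fun i hi => by rw [occupation, if_pos hi])]
  simp

theorem theorem3 {Ω : Type u} [MeasurableSpace Ω] (P : Measure Ω) [IsProbabilityMeasure P]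
    (p : PMF ℕ+) (α t : ℝ≥0) (hα : 0 < α) (ht : 0 < t)
    -- an i.i.d. sequence with distribution `p` (the first term is `X 0`)
    (X : ℕ → Ω → ℕ+) (hX_meas : ∀ k, Measurable (X k))
    (hX_law : ∀ k, P.map (X k) = p.toMeasure) (hX_indep : iIndepFun X P)
    -- a Poisson random variable with mean `t`, independent of the whole sequence
    (N : Ω → ℕ) (hN_meas : Measurable N) (hN_law : P.map N = poissonMeasure t)
    (hXN : IndepFun N (fun ω k => X k ω) P) :
    -- after enlarging the probability space (along a measure-preserving map `π`),
    ∃ (Ω' : Type u) (_ : MeasurableSpace Ω') (P' : Measure Ω') (π : Ω' → Ω)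
      (I J : ℕ+ → Ω' → ℕ) (H : Ω' → ℕ),
      IsProbabilityMeasure P' ∧ MeasurePreserving π P' P ∧
      -- there are two sequences of independent Bernoulli variables
      (∀ i, Measurable (I i)) ∧ (∀ i, P'.map (I i) = bernoulliNat (bernoulliParam p α i)) ∧
      iIndepFun I P' ∧
      (∀ i, Measurable (J i)) ∧ (∀ i, P'.map (J i) = bernoulliNat (bernoulliParam p α i)) ∧
      iIndepFun J P' ∧
      -- and a Poisson variable with mean `α t`
      Measurable H ∧ P'.map H = poissonMeasure (α * t) ∧
      -- such that both bounds hold almost surely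
      (∀ᵐ ω ∂P',
        (lisLength (fun k : Fin (N (π ω)) => X k (π ω)) : ℝ≥0∞)
          ≤ (H ω : ℝ≥0∞) + ∑' i : ℕ+, (I i ω : ℝ≥0∞)) ∧
      (∀ᵐ ω ∂P',
        min (H ω : ℝ≥0∞) (∑' i : ℕ+, (J i ω : ℝ≥0∞))
          ≤ (lisLength (fun k : Fin (N (π ω)) => X k (π ω)) : ℝ≥0∞)) := by
  have hW := measurable_ofFn hX_meas hN_meas
  have hμW := map_ofFn_singleton hX_meas hX_law hX_indep hN_meas hN_law hXN
  have := isProbabilityMeasure_sourceMeasure p hα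
  have := Measure.isProbabilityMeasure_map (μ := P) hW.aemeasurable
  have hmarks := map_markListMeasure p α t hμW
  -- The total mass is read off from the image, a product of two probability measures.
  have : IsProbabilityMeasure (markListMeasure p α t) := by
    have : IsProbabilityMeasure ((markListMeasure p α t).map
        fun l => (l.reduceOption, l.count none)) := by
      rw [hmarks]; infer_instance
    exact Measure.isProbabilityMeasure_of_map fun l : List (Option ℕ+) =>
      (l.reduceOption, l.count none)
  have hcount : (markListMeasure p α t).map (fun l => l.count none) = poissonMeasure (α * t) := by
    have h := congrArg (Measure.map Prod.snd) hmarks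
    rw [Measure.map_map measurable_snd measurable_from_top, Measure.map_snd_prod, measure_univ,
      one_smul] at h
    exact h
  set Q := (sourceMeasure p α).prod (markListMeasure p α t) with hQ
  have hword : P.map (fun ω => List.ofFn fun k : Fin (N ω) => X k ω)
      = Q.map fun z => z.2.reduceOption := by
    have h := congrArg (Measure.map Prod.fst) hmarks
    rw [Measure.map_map measurable_fst measurable_from_top, Measure.map_fst_prod, measure_univ,
      one_smul] at h
    rw [← h]
    have h2 : (markListMeasure p α t) = Q.map Prod.snd := by simp [hQ]
    conv_lhs => rw [h2]
    rw [Measure.map_map measurable_from_top measurable_snd]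
    rfl
  have hrun : Q.map (fun z => hammersleyRun z.1 z.2) = Q := map_hammersleyRun p t hα
  have hrun_meas : Measurable fun z : Finset ℕ+ × List (Option ℕ+) => hammersleyRun z.1 z.2 :=
    measurable_of_countable _
  obtain ⟨P', hfst, hsnd, hae⟩ := exists_coupling_of_map_eq P Q hW
    (measurable_of_countable fun z : Finset ℕ+ × List (Option ℕ+) => z.2.reduceOption) hword
  have hP' : IsProbabilityMeasure P' := by
    have : IsProbabilityMeasure (P'.map Prod.fst) := by rw [hfst]; infer_instance
    exact Measure.isProbabilityMeasure_of_map Prod.fst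
  have hS : P'.map (fun x => x.2.1) = sourceMeasure p α := by
    have h : Q.map Prod.fst = sourceMeasure p α := by simp [hQ]
    rw [← h, ← hsnd, Measure.map_map measurable_fst measurable_snd]
    rfl
  have hrun' : P'.map (fun x => hammersleyRun x.2.1 x.2.2) = Q := by
    conv_rhs => rw [← hrun, ← hsnd, Measure.map_map hrun_meas measurable_snd]
    rfl
  have hrun'_meas : Measurable fun x : Ω × (Finset ℕ+ × List (Option ℕ+)) =>
    hammersleyRun x.2.1 x.2.2 := hrun_meas.comp measurable_snd
  have hS' : P'.map (fun x => (hammersleyRun x.2.1 x.2.2).1) = sourceMeasure p α := by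
    have h : Q.map Prod.fst = sourceMeasure p α := by simp [hQ]
    rw [← h, ← hrun', Measure.map_map measurable_fst hrun'_meas]
    rfl
  have hH_meas : Measurable fun x : Ω × (Finset ℕ+ × List (Option ℕ+)) =>
      (hammersleyRun x.2.1 x.2.2).2.count none :=
    (measurable_from_top (f := fun l : List (Option ℕ+) => l.count none)).comp
      (measurable_snd.comp hrun'_meas)
  have hH : P'.map (fun x => (hammersleyRun x.2.1 x.2.2).2.count none)
      = poissonMeasure (α * t) := by
    have h : Q.map Prod.snd = markListMeasure p α t := by simp [hQ]
    rw [← hcount, ← h, ← hrun', Measure.map_map measurable_snd hrun'_meas,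
      Measure.map_map measurable_from_top (measurable_snd.comp hrun'_meas)]
    rfl
  obtain ⟨hI1, hI2, hI3⟩ :=
    bernoulli_occupation p hα (measurable_fst.comp measurable_snd) hS
  obtain ⟨hJ1, hJ2, hJ3⟩ := bernoulli_occupation p hα (measurable_fst.comp hrun'_meas) hS'
  -- I is the occupation of the initial configuration, J that of the final one, and H counts the
  -- outputs `none`.
  refine ⟨Ω × (Finset ℕ+ × List (Option ℕ+)), inferInstance, P', Prod.fst, _, _, _, hP',
    ⟨measurable_fst, hfst⟩, hI1, hI2, hI3, hJ1, hJ2, hJ3, hH_meas, hH, ?_, ?_⟩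
  · filter_upwards [hae] with x hx
    rw [← lisLength_get_ofFn, hx, tsum_occupation]
    exact_mod_cast lisLength_le_count_hammersleyRun_add_card x.2.1 x.2.2
  · filter_upwards [hae] with x hx
    rw [← lisLength_get_ofFn, hx, tsum_occupation]
    simp only [Function.comp_apply]
    rw [← (Nat.mono_cast (α := ℝ≥0∞)).map_min, Nat.cast_le]
    exact min_count_card_hammersleyRun_le_lisLength x.2.1 x.2.2
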